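/- Consider a finite discounted constrained Markov decision process (CMDP): finite sets $\mathcal S,\mathcal A$, transition probabilities $\mathcal P(\cdot\mid s,a)$, initial distribution $\rho$, discount $\gamma\in[0,1)$, reward $r:\mathcal S\times\mathcal A\to[0,1]$, constraint rewards $c_i:\mathcal S\times\mathcal A\to[0,1]$ and thresholds $b_i\ge 0$, $i=1,\dots,m$. For a stationary stochastic policy $\pi$, which assigns to each state a probability distribution on $\mathcal A$, let $V^\pi_f(\rho)=\mathbb E\big[\sum_{\tau\ge0}\gamma^\tau f(s_\tau,a_\tau)\big]$ with $s_0\sim\rho$, $a_\tau\sim\pi(\cdot\mid s_\tau)$, $s_{\tau+1}\sim\mathcal P(\cdot\mid s_\tau,a_\tau)$. Assume that the problem $$\max_\pi V^\pi_r(\rho)\quad\text{s.t.}\quad V^\pi_{c_i}(\rho)\ge b_i,\ i=1,\dots,m \qquad (*)$$ is feasible. For $\beta>0$ let $$\mathcal L^\beta(\pi,\lambda)=V^\pi_r(\rho)+\frac\beta2\sum_{i=1}^m\Big(-\min\{V^\pi_{c_i}(\rho)-b_i-\tfrac{\lambda_i}{\beta},0\}^2+\tfrac{\lambda_i^2}{\beta^2}\Big).$$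 The inexact augmented Lagrangian method starts from $\lambda_1=0$. In iteration $t=1,\dots,T$ an oracle returns a policy $\pi_{t+1}$ with $\mathcal L^\beta(\pi_{t+1},\lambda_t)\ge\max_\pi\mathcal L^\beta(\pi,\lambda_t)-\epsilon_t$, and then $$\lambda_{t+1,i}=\lambda_{t,i}-\frac\beta2\big(V^{\pi_{t+1}}_{c_i}(\rho)-b_i-\xi_{t,i}\big),\qquad \xi_{t,i}=\max\{V^{\pi_{t+1}}_{c_i}(\rho)-b_i-\tfrac{\lambda_{t,i}}{\beta},0\},\qquad i=1,\dots,m.$$ After $T$ iterations the method returns $\pi_{T+1}$. **Theorem.** For every feasible CMDP, every $\beta>0$ and every $\sigma>0$ there is a constant $C>0$, depending only on these data, such that for all $\varepsilon\in(0,1)$ and all integers $T\ge C/\varepsilon^2$: for all accuracies $0\le\epsilon_t\le\sigma/t^2$ ($1\le t\le T$) and all answers of the oracle, the returned last-iterate policy $\pi_{T+1}$ is an $\varepsilon$-approximate solution of $(*)$, that is, $$V^{\pi_{T+1}}_r(\rho)\ \ge\ \max_{\pi:\ V^\pi_{c_j}(\rho)\ge b_j\ \forall j}V^\pi_r(\rho)-\varepsilon\qquad\text{and}\qquad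 V^{\pi_{T+1}}_{c_i}(\rho)\ \ge\ b_i-\varepsilon\quad(i=1,\dots,m).$$ -/

import Mathlib

noncomputable section

/-- A finite discounted constrained Markov decision process with `m` constraints. -/
structure CMDP (S A : Type*) [Fintype S] [Fintype A] (m : ℕ) where
  /-- transition probabilities `P(· | s, a)` -/
  P : S → A → stdSimplex ℝ S
  /-- initial state distribution -/
  ρ : stdSimplex ℝ S
  /-- discount factor -/
  γ : ℝ
  /-- reward function -/
  r : S → A → ℝ
  /-- constraint reward functions -/
  c : Fin m → S → A → ℝ
  /-- constraint thresholds -/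
  b : Fin m → ℝ
  γ_mem : γ ∈ Set.Ico (0 : ℝ) 1
  r_mem : ∀ s a, r s a ∈ Set.Icc (0 : ℝ) 1
  c_mem : ∀ i s a, c i s a ∈ Set.Icc (0 : ℝ) 1
  b_nonneg : ∀ i, 0 ≤ b i

/-- Stationary stochastic policies `π : S → Δ_A`. -/
abbrev Policy (S A : Type*) [Fintype A] : Type _ := S → stdSimplex ℝ A

namespace CMDP

variable {S A : Type*} [Fintype S] [Fintype A] {m : ℕ}

open Classical in
/-- `M.stateActionProb π s₀ a₀ τ s a` is the probability that `(s_τ, a_τ) = (s, a)` in the chain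
that starts at `(s₀, a₀)` and follows `s_{τ+1} ∼ P(· | s_τ, a_τ)`, `a_{τ+1} ∼ π(· | s_{τ+1})`. -/
def stateActionProb (M : CMDP S A m) (π : Policy S A) (s₀ : S) (a₀ : A) : ℕ → S → A → ℝ
  | 0 => fun s a => if s = s₀ ∧ a = a₀ then 1 else 0
  | τ + 1 => fun s' a' =>
      (∑ s, ∑ a, M.stateActionProb π s₀ a₀ τ s a * (M.P s a : S → ℝ) s') * (π s' : A → ℝ) a'

/-- State-action value function: the expected discounted sum of the (pseudo-)reward `f` along the
chain started at `(s, a)`. -/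
def Q (M : CMDP S A m) (f : S → A → ℝ) (π : Policy S A) (s : S) (a : A) : ℝ :=
  ∑' τ : ℕ, M.γ ^ τ * ∑ s', ∑ a', M.stateActionProb π s a τ s' a' * f s' a'

/-- Value function `V^π_f(s)`, the mean of `Q^π_f(s, a)` over `a ∼ π(· | s)`. -/
def V (M : CMDP S A m) (f : S → A → ℝ) (π : Policy S A) (s : S) : ℝ :=
  ∑ a, (π s : A → ℝ) a * M.Q f π s a

/-- Expected value function `V^π_f(ρ)`, the mean of `V^π_f(s₀)` over `s₀ ∼ ρ`. -/
def value (M : CMDP S A m) (f : S → A → ℝ) (π : Policy S A) : ℝ :=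
  ∑ s, (M.ρ : S → ℝ) s * M.V f π s

/-- The constraints `V^π_{c_i}(ρ) ≥ b_i` for all `i`. -/
def Feasible (M : CMDP S A m) (π : Policy S A) : Prop :=
  ∀ i, M.b i ≤ M.value (M.c i) π

/-- `π` is an `ε`-approximate solution of `max_π V^π_r(ρ)` subject to the constraints: its value is
within `ε` of the constrained optimum, and each constraint is violated by at most `ε`. -/
def IsApproxSolution (M : CMDP S A m) (ε : ℝ) (π : Policy S A) : Prop :=
  (∀ π' : Policy S A, M.Feasible π' → M.value M.r π' - ε ≤ M.value M.r π) ∧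
    ∀ i, M.b i - ε ≤ M.value (M.c i) π

/-- The augmented Lagrangian `L^β(π, lam)`. -/
def augLagrangian (M : CMDP S A m) (β : ℝ) (π : Policy S A) (lam : Fin m → ℝ) : ℝ :=
  M.value M.r π + β / 2 * ∑ i,
    (-(min (M.value (M.c i) π - M.b i - lam i / β) 0) ^ 2 + lam i ^ 2 / β ^ 2)

/-- What the oracle guarantees: `π` maximises `L^β(·, lam)` over all policies up to `e`. -/
def IsApproxMaximizer (M : CMDP S A m) (β : ℝ) (lam : Fin m → ℝ) (e : ℝ) (π : Policy S A) : Prop :=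
  ∀ π' : Policy S A, M.augLagrangian β π' lam - e ≤ M.augLagrangian β π lam

/-- The slack `ξ_i(π)` at the multiplier `lam`. -/
def slack (M : CMDP S A m) (β : ℝ) (lam : Fin m → ℝ) (π : Policy S A) (i : Fin m) : ℝ :=
  max (M.value (M.c i) π - M.b i - lam i / β) 0

/-- `π 1, …, π (T+1)` and `lam 1, …, lam (T+1)` are the primal and dual iterates of `T` iterations
of the inexact augmented Lagrangian method with penalty `β`, accuracies `e 1, …, e T`, `lam 1 = 0`;
`π (T+1)` is the policy returned. -/
structure IsALRun (M : CMDP S A m) (β : ℝ) (e : ℕ → ℝ) (T : ℕ)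
    (π : ℕ → Policy S A) (lam : ℕ → Fin m → ℝ) : Prop where
  init : lam 1 = 0
  primal : ∀ t, 1 ≤ t → t ≤ T → M.IsApproxMaximizer β (lam t) (e t) (π (t + 1))
  dual : ∀ t, 1 ≤ t → t ≤ T → ∀ i, lam (t + 1) i =
    lam t i - β / 2 *
      (M.value (M.c i) (π (t + 1)) - (M.b i + M.slack β (lam t) (π (t + 1)) i))

end CMDP

end

/-!
The argument views the augmented Lagrangian method as inexact gradient descent on a smooth convex
function of the multiplier, and carries a rate for that function over to the primal iterate.

Write `f` for the value of the objective and `g i` for the constraint slacks `V_{c_i} - b_i`. Via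
occupancy measures the attainable pairs `(f, g)` form a compact convex set `Z`, the affine image of
a polytope (`CMDP.occupancy_mem`, `CMDP.exists_occupancy_eq`, `CMDP.isCompact_occupancySet`). The
CMDP is therefore a linear program, and Farkas' lemma gives a Lagrange multiplier `ls` as soon as
the program is feasible, without a Slater point (`CMDP.exists_multiplier`).

Let `p l` be the maximum over `Z` of the augmented Lagrangian at `l`
(`AugLagrangian.envelope`). Since the augmented Lagrangian at `z` is the minimum over `y ≥ 0` of
the Lagrangian plus `‖y - l‖² / (2β)`, `p` is the Moreau envelope of the dual function: convex,
`1/β`-smooth, with minimum the constrained optimum, attained at `ls`. The multiplier update is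
`l - (β/2) G`, where `G i = min (g i) (l i / β)` is the gradient in `l` of the augmented Lagrangian
at the oracle's answer. An answer that is optimal up to `e` provides an `e`-subgradient of `p`, so
one step satisfies

* `p l' ≤ p l + e - (β/4) ‖G‖²` (`AugLagrangian.envelope_step_le`),
* `‖l' - ls‖² + β (p l' - p ls) ≤ ‖l - ls‖² + 2βe` (`AugLagrangian.sum_sq_step_le`).

Both losses are linear in `e`, hence summable for `e t ≤ σ/t²`. The gaps `p (l t) - p ls` thus have
bounded sum and increase by at most `σ/t²` at step `t`; as the tails of `∑ σ/t²` are `O(1/t)`, the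
last gap is `O(1/T)` with no logarithmic factor (`AugLagrangian.last_gap_le`). The first inequality
then gives `‖G‖² = O(1/T)` at the last step. Since `G i ≤ g i`, the constraint violation is
`O(1/√T)`, and since `f ≥ p (l T) - e T - ⟨l T, G⟩` with bounded multipliers, so is the loss in the
objective.
-/

noncomputable section

/-! ### Farkas' lemma and Lagrange multipliers of linear programs -/

/-- **Farkas' lemma** for finitely many linear forms on a real vector space, by induction on the
number of forms (Bartl's argument). -/
theorem exists_nonneg_combination_of_finset {W κ : Type*} [AddCommGroup W] [Module ℝ W]
    (s : Finset κ) : ∀ (α : κ → W →ₗ[ℝ] ℝ) (φ : W →ₗ[ℝ] ℝ),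
      (∀ w, (∀ k ∈ s, 0 ≤ α k w) → 0 ≤ φ w) →
      ∃ μ : κ → ℝ, (∀ k, 0 ≤ μ k) ∧ ∀ w, φ w = ∑ k ∈ s, μ k * α k w := by
  classical
  induction s using Finset.induction_on with
  | empty =>
    intro α φ h
    refine ⟨0, fun _ => le_rfl, fun w => ?_⟩
    have h1 := h w (by simp)
    have h2 := h (-w) (by simp)
    rw [map_neg] at h2
    simp only [Finset.sum_empty]
    linarith
  | insert j s hj ih =>
    intro α φ h
    by_cases hs : ∀ w, (∀ k ∈ s, 0 ≤ α k w) → 0 ≤ φ w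
    · obtain ⟨μ, hμ, hφ⟩ := ih α φ hs
      refine ⟨Function.update μ j 0, fun k => ?_, fun w => ?_⟩
      · by_cases hk : k = j
        · simp [hk]
        · simpa [Function.update_of_ne hk] using hμ k
      · rw [Finset.sum_insert hj, hφ w]
        simp only [Function.update_self, zero_mul, zero_add]
        refine Finset.sum_congr rfl fun k hk => ?_
        rw [Function.update_of_ne (by rintro rfl; exact hj hk)]
    · push Not at hs
      obtain ⟨w₁, hw₁, hφ₁⟩ := hs
      have hneg : α j w₁ < 0 := by
        by_contra! hcon
        refine absurd (h w₁ fun k hk => ?_) (not_le.2 hφ₁)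
        rcases Finset.mem_insert.1 hk with rfl | hk
        exacts [hcon, hw₁ k hk]
      -- Normalise the violating vector so that the new form takes the value `-1` at it, and
      -- project along it onto the kernel of the new form.
      set w₀ : W := (-(α j w₁))⁻¹ • w₁ with hw₀
      have hpos : 0 < (-(α j w₁))⁻¹ := inv_pos.2 (by linarith)
      have hj₀ : α j w₀ = -1 := by
        rw [hw₀, map_smul, smul_eq_mul, inv_neg, neg_mul, inv_mul_cancel₀ hneg.ne]
      have hα₀ : ∀ k ∈ s, 0 ≤ α k w₀ := fun k hk => by
        rw [hw₀, map_smul]; exact mul_nonneg hpos.le (hw₁ k hk)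
      have hφ₀ : φ w₀ ≤ 0 := by
        rw [hw₀, map_smul]; exact mul_nonpos_of_nonneg_of_nonpos hpos.le hφ₁.le
      obtain ⟨μ, hμ, hμφ⟩ := ih (fun k => α k + α k w₀ • α j) (φ + φ w₀ • α j) (by
        intro w hw
        have := h (w + α j w • w₀) (by
          intro k hk
          rcases Finset.mem_insert.1 hk with rfl | hk
          · simp [hj₀]
          · have := hw k hk
            simp only [LinearMap.add_apply, LinearMap.smul_apply, smul_eq_mul] at this
            simp only [map_add, map_smul, smul_eq_mul]
            linarith)
        simp only [map_add, map_smul, smul_eq_mul] at this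
        simp only [LinearMap.add_apply, LinearMap.smul_apply, smul_eq_mul]
        linarith)
      refine ⟨Function.update μ j (∑ k ∈ s, μ k * α k w₀ - φ w₀), fun k => ?_, fun w => ?_⟩
      · by_cases hk : k = j
        · subst hk
          rw [Function.update_self]
          have := Finset.sum_nonneg fun k hk => mul_nonneg (hμ k) (hα₀ k hk)
          linarith
        · simpa [Function.update_of_ne hk] using hμ k
      · have := hμφ w
        simp only [LinearMap.add_apply, LinearMap.smul_apply, smul_eq_mul, mul_add,
          Finset.sum_add_distrib] at this
        have h1 : ∑ k ∈ s, Function.update μ j (∑ k ∈ s, μ k * α k w₀ - φ w₀) k * α k w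
            = ∑ k ∈ s, μ k * α k w := Finset.sum_congr rfl fun k hk => by
          rw [Function.update_of_ne (by rintro rfl; exact hj hk)]
        have h2 : ∑ k ∈ s, μ k * (α k w₀ * α j w) = (∑ k ∈ s, μ k * α k w₀) * α j w := by
          rw [Finset.sum_mul]; exact Finset.sum_congr rfl fun k _ => by ring
        rw [Finset.sum_insert hj, Function.update_self, h1]
        rw [h2] at this
        linarith

/-- Lagrange multipliers of a homogeneous linear program: only the constraints `g` are dualised,
the constraints `α` are kept. No constraint qualification is needed. -/
theorem exists_multiplier_of_homogeneous {W κ ι : Type*} [AddCommGroup W] [Module ℝ W]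
    [Fintype κ] [Fintype ι] (α : κ → W →ₗ[ℝ] ℝ) (g : ι → W →ₗ[ℝ] ℝ) (h : W →ₗ[ℝ] ℝ)
    (hle : ∀ w, (∀ k, 0 ≤ α k w) → (∀ i, 0 ≤ g i w) → h w ≤ 0) :
    ∃ μ : ι → ℝ, (∀ i, 0 ≤ μ i) ∧
      ∀ w, (∀ k, 0 ≤ α k w) → h w + ∑ i, μ i * g i w ≤ 0 := by
  obtain ⟨μ, hμ, hh⟩ := exists_nonneg_combination_of_finset Finset.univ (Sum.elim α g) (-h) (by
    intro w hw
    have := hle w (fun k => hw (Sum.inl k) (Finset.mem_univ _))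
      (fun i => hw (Sum.inr i) (Finset.mem_univ _))
    simpa using this)
  refine ⟨fun i => μ (Sum.inr i), fun i => hμ _, fun w hw => ?_⟩
  have := hh w
  rw [Fintype.sum_sum_type] at this
  simp only [Sum.elim_inl, Sum.elim_inr, LinearMap.neg_apply] at this
  have h1 := Finset.sum_nonneg fun k (_ : k ∈ Finset.univ) => mul_nonneg (hμ (Sum.inl k)) (hw k)
  linarith

/-! ### The augmented Lagrangian of a concave program -/

namespace AugLagrangian

/-- The contribution to the augmented Lagrangian of one constraint `0 ≤ g` with multiplier `l`. -/
def term (β g l : ℝ) : ℝ := (l ^ 2 - (max (l - β * g) 0) ^ 2) / (2 * β)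

/-- The derivative of `term β g` at `l`. -/
def grad (β g l : ℝ) : ℝ := min g (l / β)

section Scalar

variable {β : ℝ}

theorem max_eq_sub_grad (hβ : 0 < β) (g l : ℝ) : max (l - β * g) 0 = l - β * grad β g l := by
  unfold grad
  have h : β * (l / β) = l := by field_simp
  rcases le_total g (l / β) with h1 | h1
  · rw [min_eq_left h1, max_eq_left]
    nlinarith
  · rw [min_eq_right h1, max_eq_right] <;> nlinarith

/-- The augmented Lagrangian is the partial minimum over `y ≥ 0` of the Lagrangian plus a proximal
term; the minimiser is `max (l - β * g) 0`. -/
theorem term_le (hβ : 0 < β) (g l : ℝ) {y : ℝ} (hy : 0 ≤ y) :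
    term β g l ≤ y * g + (y - l) ^ 2 / (2 * β) := by
  have : y * g + (y - l) ^ 2 / (2 * β) = (2 * β * (y * g) + (y - l) ^ 2) / (2 * β) := by
    field_simp
  rw [this, term]
  gcongr
  rcases le_total (l - β * g) 0 with h1 | h1
  · rw [max_eq_right h1]; nlinarith [mul_nonneg hy (neg_nonneg.2 h1), sq_nonneg y]
  · rw [max_eq_left h1]; nlinarith [sq_nonneg (y - (l - β * g))]

theorem term_eq (hβ : 0 < β) (g l : ℝ) :
    term β g l = (l - β * grad β g l) * g + β / 2 * grad β g l ^ 2 := by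
  have h0 : (l - β * grad β g l) * g = (l - β * grad β g l) * grad β g l := by
    unfold grad
    rcases le_total g (l / β) with h1 | h1
    · rw [min_eq_left h1]
    · rw [min_eq_right h1]
      have h : β * (l / β) = l := by field_simp
      rw [h]; ring
  rw [h0, term, max_eq_sub_grad hβ]
  field_simp
  ring

/-- `term β g` is convex. -/
theorem term_add_grad_le (hβ : 0 < β) (g l l' : ℝ) :
    term β g l + grad β g l * (l' - l) ≤ term β g l' := by
  have hl : β * (l / β) = l := by field_simp
  have hl' : β * (l' / β) = l' := by field_simp
  rw [term_eq hβ, term_eq hβ]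
  unfold grad
  set u := l / β
  set v := l' / β
  rw [← hl, ← hl']
  rcases le_total g u with h1 | h1 <;> rcases le_total g v with h2 | h2 <;>
    simp only [min_eq_left, min_eq_right, h1, h2]
  · nlinarith
  · nlinarith [mul_nonneg hβ.le (sq_nonneg (v - g))]
  · nlinarith [mul_nonneg hβ.le (mul_nonneg (sub_nonneg.2 h1) (sub_nonneg.2 h2)),
      mul_nonneg hβ.le (sq_nonneg (u - g))]
  · nlinarith [mul_nonneg hβ.le (sq_nonneg (u - v))]

/-- `term β · l` is concave, with a `β`-Lipschitz derivative `max (l - β * g) 0`. -/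
theorem le_term_add (hβ : 0 < β) (g l d : ℝ) :
    term β g l + max (l - β * g) 0 * d - β / 2 * d ^ 2 ≤ term β (g + d) l := by
  have : term β g l + max (l - β * g) 0 * d - β / 2 * d ^ 2
      = (l ^ 2 - (max (l - β * g) 0 - β * d) ^ 2) / (2 * β) := by
    unfold term; field_simp; ring
  rw [this, term]
  refine div_le_div_of_nonneg_right (sub_le_sub_left ?_ _) (by positivity)
  rw [show l - β * (g + d) = l - β * g - β * d by ring]
  generalize l - β * g = u
  generalize β * d = v
  rcases le_total u 0 with h1 | h1 <;> rcases le_total (u - v) 0 with h2 | h2 <;>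
    simp only [max_eq_left, max_eq_right, h1, h2] <;> nlinarith

theorem term_nonneg (hβ : 0 < β) {g : ℝ} (hg : 0 ≤ g) (l : ℝ) : 0 ≤ term β g l := by
  have := term_add_grad_le hβ g 0 l
  rw [term_eq hβ] at this
  simpa [grad, hg] using this

theorem term_le_mul_grad (hβ : 0 < β) (g l : ℝ) : term β g l ≤ l * grad β g l := by
  have h := term_add_grad_le hβ g l 0
  have h0 : term β g 0 ≤ 0 := by simpa using term_le hβ g 0 le_rfl
  linarith

end Scalar

variable {ι : Type*} [Fintype ι] {β : ℝ}

/-- The augmented Lagrangian at a point `z = (f, g)`, where `f` is the value of the objective and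
`0 ≤ g i` are the constraints. -/
def lagr (β : ℝ) (z : ℝ × (ι → ℝ)) (l : ι → ℝ) : ℝ := z.1 + ∑ i, term β (z.2 i) (l i)

/-- The maximum over `Z` of the augmented Lagrangian, as a function of the multiplier: the Moreau
envelope of the dual function. -/
def envelope (β : ℝ) (Z : Set (ℝ × (ι → ℝ))) (l : ι → ℝ) : ℝ := sSup ((fun z => lagr β z l) '' Z)

theorem continuous_lagr (β : ℝ) (l : ι → ℝ) : Continuous fun z => lagr β z l := by
  unfold lagr term
  fun_prop

variable {Z : Set (ℝ × (ι → ℝ))}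

theorem lagr_le_envelope (hZ : IsCompact Z) {z : ℝ × (ι → ℝ)} (hz : z ∈ Z) (l : ι → ℝ) :
    lagr β z l ≤ envelope β Z l :=
  le_csSup (hZ.image (continuous_lagr β l)).bddAbove (Set.mem_image_of_mem _ hz)

theorem envelope_le (hne : Z.Nonempty) {l : ι → ℝ} {x : ℝ} (h : ∀ z ∈ Z, lagr β z l ≤ x) :
    envelope β Z l ≤ x :=
  csSup_le (hne.image _) (by rintro _ ⟨z, hz, rfl⟩; exact h z hz)

theorem exists_lagr_eq_envelope (hZ : IsCompact Z) (hne : Z.Nonempty) (l : ι → ℝ) :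
    ∃ z ∈ Z, lagr β z l = envelope β Z l := by
  obtain ⟨z, hz, h⟩ := hZ.exists_sSup_image_eq hne (continuous_lagr β l).continuousOn
  exact ⟨z, hz, h.symm⟩

/-- First-order optimality: a maximiser over a convex set of the augmented Lagrangian at `l`
maximises the ordinary Lagrangian at the updated multiplier `max (l - β * g) 0`. -/
theorem lagrangian_le_of_isMax (hβ : 0 < β) (hconv : Convex ℝ Z) {l : ι → ℝ}
    {z₀ z : ℝ × (ι → ℝ)} (hz₀ : z₀ ∈ Z) (hz : z ∈ Z)
    (hmax : ∀ z ∈ Z, lagr β z l ≤ lagr β z₀ l) :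
    z.1 + ∑ i, max (l i - β * z₀.2 i) 0 * z.2 i
      ≤ z₀.1 + ∑ i, max (l i - β * z₀.2 i) 0 * z₀.2 i := by
  set y : ι → ℝ := fun i => max (l i - β * z₀.2 i) 0
  set Δ : ℝ := z.1 - z₀.1 + ∑ i, y i * (z.2 i - z₀.2 i) with hΔ
  set B : ℝ := ∑ i, (z.2 i - z₀.2 i) ^ 2 with hB
  have hB0 : 0 ≤ B := Finset.sum_nonneg fun i _ => sq_nonneg _
  have key : ∀ s : ℝ, 0 ≤ s → s ≤ 1 → s * Δ ≤ β / 2 * s ^ 2 * B := by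
    intro s hs0 hs1
    have h := hmax _ (hconv.add_smul_sub_mem hz₀ hz ⟨hs0, hs1⟩)
    have hsum : ∑ i, (term β (z₀.2 i) (l i) + y i * (s * (z.2 i - z₀.2 i))
          - β / 2 * (s * (z.2 i - z₀.2 i)) ^ 2)
        ≤ ∑ i, term β (z₀.2 i + s * (z.2 i - z₀.2 i)) (l i) :=
      Finset.sum_le_sum fun i _ => le_term_add hβ _ _ _
    have hsplit : ∑ i, (term β (z₀.2 i) (l i) + y i * (s * (z.2 i - z₀.2 i))
          - β / 2 * (s * (z.2 i - z₀.2 i)) ^ 2)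
        = ∑ i, term β (z₀.2 i) (l i) + s * ∑ i, y i * (z.2 i - z₀.2 i)
          - β / 2 * s ^ 2 * B := by
      rw [hB, Finset.mul_sum, Finset.mul_sum, ← Finset.sum_add_distrib, ← Finset.sum_sub_distrib]
      exact Finset.sum_congr rfl fun i _ => by ring
    simp only [lagr, Prod.fst_add, Prod.smul_fst, Prod.fst_sub, Prod.snd_add, Prod.smul_snd,
      Prod.snd_sub, Pi.add_apply, Pi.smul_apply, Pi.sub_apply, smul_eq_mul] at h
    rw [hΔ, mul_add]
    linarith
  have hΔ0 : Δ ≤ 0 := by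
    by_contra! hpos
    have hden : 0 < β * B + Δ := by positivity
    have h := key (Δ / (β * B + Δ)) (by positivity)
      ((div_le_one hden).2 (by nlinarith [mul_nonneg hβ.le hB0]))
    have h1 : Δ / (β * B + Δ) * (β * B + Δ) = Δ := div_mul_cancel₀ _ hden.ne'
    have hs : 0 < Δ / (β * B + Δ) := by positivity
    set s := Δ / (β * B + Δ)
    have h2 : Δ ≤ β / 2 * s * B := by
      refine le_of_mul_le_mul_left ?_ hs
      linarith
    have h3 : 0 < s * Δ := by positivity
    nlinarith
  have : ∑ i, y i * (z.2 i - z₀.2 i) = ∑ i, y i * z.2 i - ∑ i, y i * z₀.2 i := by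
    rw [← Finset.sum_sub_distrib]
    exact Finset.sum_congr rfl fun i _ => by ring
  linarith

/-- The envelope is `1/β`-smooth: it lies below a quadratic that touches it at `l`. -/
theorem exists_envelope_le_quadratic (hβ : 0 < β) (hZ : IsCompact Z) (hne : Z.Nonempty)
    (hconv : Convex ℝ Z) (l : ι → ℝ) :
    ∃ q : ι → ℝ, ∀ l' : ι → ℝ, envelope β Z l' ≤
      envelope β Z l + ∑ i, q i * (l' i - l i) + ∑ i, (l' i - l i) ^ 2 / (2 * β) := by
  obtain ⟨z₀, hz₀, h₀⟩ := exists_lagr_eq_envelope (β := β) hZ hne l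
  have hmax : ∀ z ∈ Z, lagr β z l ≤ lagr β z₀ l := fun z hz => h₀ ▸ lagr_le_envelope hZ hz l
  refine ⟨fun i => grad β (z₀.2 i) (l i), fun l' => envelope_le hne fun z hz => ?_⟩
  have h1 := lagrangian_le_of_isMax hβ hconv hz₀ hz hmax
  have h2 : ∑ i, term β (z.2 i) (l' i) ≤ ∑ i, (max (l i - β * z₀.2 i) 0 * z.2 i
      + (max (l i - β * z₀.2 i) 0 - l' i) ^ 2 / (2 * β)) :=
    Finset.sum_le_sum fun i _ => term_le hβ _ _ (le_max_right _ _)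
  have h3 : ∑ i, (max (l i - β * z₀.2 i) 0 * z₀.2 i
      + (max (l i - β * z₀.2 i) 0 - l' i) ^ 2 / (2 * β))
      = ∑ i, term β (z₀.2 i) (l i) + ∑ i, grad β (z₀.2 i) (l i) * (l' i - l i)
        + ∑ i, (l' i - l i) ^ 2 / (2 * β) := by
    rw [← Finset.sum_add_distrib, ← Finset.sum_add_distrib]
    refine Finset.sum_congr rfl fun i _ => ?_
    rw [term_eq hβ, max_eq_sub_grad hβ]
    field_simp
    ring
  rw [Finset.sum_add_distrib] at h2 h3
  rw [← h₀]
  unfold lagr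
  linarith

/-- An inexact maximiser of the augmented Lagrangian yields an inexact subgradient of the
envelope. -/
theorem lagr_add_grad_le_envelope (hβ : 0 < β) (hZ : IsCompact Z) {z : ℝ × (ι → ℝ)} (hz : z ∈ Z)
    (l l' : ι → ℝ) :
    lagr β z l + ∑ i, grad β (z.2 i) (l i) * (l' i - l i) ≤ envelope β Z l' := by
  refine le_trans ?_ (lagr_le_envelope hZ hz l')
  unfold lagr
  rw [add_assoc, ← Finset.sum_add_distrib]
  gcongr
  exact term_add_grad_le hβ _ _ _

/-- Descent of the envelope along an inexact gradient step of length `β / 2`, half the inverse of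
the smoothness constant. The loss is the oracle error itself, not its square root. -/
theorem envelope_step_le (hβ : 0 < β) (hZ : IsCompact Z) (hconv : Convex ℝ Z)
    {z : ℝ × (ι → ℝ)} (hz : z ∈ Z) {l l' : ι → ℝ} {e : ℝ} (he : envelope β Z l - e ≤ lagr β z l)
    (hl' : ∀ i, l' i = l i - β / 2 * grad β (z.2 i) (l i)) :
    envelope β Z l' ≤ envelope β Z l + e - β / 4 * ∑ i, grad β (z.2 i) (l i) ^ 2 := by
  obtain ⟨q, hq⟩ := exists_envelope_le_quadratic hβ hZ ⟨z, hz⟩ hconv l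
  -- The subgradient inequality at the reflected point `2 * l - l'` compares the inexact gradient
  -- with the exact one, `q`.
  have h1 := lagr_add_grad_le_envelope hβ hZ hz l fun i => l i + β / 2 * grad β (z.2 i) (l i)
  have h2 := hq fun i => l i + β / 2 * grad β (z.2 i) (l i)
  have h3 := hq l'
  simp only [hl', add_sub_cancel_left, sub_sub_cancel_left] at h1 h2 h3
  set p : ι → ℝ := fun i => grad β (z.2 i) (l i)
  have e1 : ∑ i, p i * (β / 2 * p i) = β / 2 * ∑ i, p i ^ 2 := by
    rw [Finset.mul_sum]; exact Finset.sum_congr rfl fun i _ => by ring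
  have e2 : ∑ i, q i * (β / 2 * p i) = β / 2 * ∑ i, q i * p i := by
    rw [Finset.mul_sum]; exact Finset.sum_congr rfl fun i _ => by ring
  have e3 : ∑ i, q i * -(β / 2 * p i) = -(β / 2 * ∑ i, q i * p i) := by
    rw [Finset.mul_sum, ← Finset.sum_neg_distrib]; exact Finset.sum_congr rfl fun i _ => by ring
  have e4 : ∑ i, (β / 2 * p i) ^ 2 / (2 * β) = β / 8 * ∑ i, p i ^ 2 := by
    rw [Finset.mul_sum]; exact Finset.sum_congr rfl fun i _ => by field_simp; ring
  have e5 : ∑ i, (-(β / 2 * p i)) ^ 2 / (2 * β) = β / 8 * ∑ i, p i ^ 2 := by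
    rw [← e4]; exact Finset.sum_congr rfl fun i _ => by rw [neg_sq]
  change lagr β z l + ∑ i, p i * (β / 2 * p i) ≤ _ at h1
  change _ ≤ _ + ∑ i, q i * (β / 2 * p i) + ∑ i, (β / 2 * p i) ^ 2 / (2 * β) at h2
  change _ ≤ _ + ∑ i, q i * -(β / 2 * p i) + ∑ i, (-(β / 2 * p i)) ^ 2 / (2 * β) at h3
  change _ ≤ _ - β / 4 * ∑ i, p i ^ 2
  rw [e1] at h1
  rw [e2, e4] at h2
  rw [e3, e5] at h3
  linarith

/-- The step decreases the squared distance to any multiplier `ls` at which the envelope is at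
most `v`, up to the oracle error. -/
theorem sum_sq_step_le (hβ : 0 < β) (hZ : IsCompact Z) (hconv : Convex ℝ Z)
    {z : ℝ × (ι → ℝ)} (hz : z ∈ Z) {l l' ls : ι → ℝ} {e v : ℝ}
    (he : envelope β Z l - e ≤ lagr β z l)
    (hl' : ∀ i, l' i = l i - β / 2 * grad β (z.2 i) (l i)) (hls : envelope β Z ls ≤ v) :
    ∑ i, (l' i - ls i) ^ 2 + β * (envelope β Z l' - v)
      ≤ ∑ i, (l i - ls i) ^ 2 + 2 * β * e := by
  have h1 := envelope_step_le hβ hZ hconv hz he hl'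
  have h2 := lagr_add_grad_le_envelope hβ hZ hz l ls
  have h3 : ∑ i, (l' i - ls i) ^ 2 = ∑ i, (l i - ls i) ^ 2
      + β * ∑ i, grad β (z.2 i) (l i) * (ls i - l i)
      + β * (β / 4 * ∑ i, grad β (z.2 i) (l i) ^ 2) := by
    simp only [Finset.mul_sum, ← Finset.sum_add_distrib]
    exact Finset.sum_congr rfl fun i _ => by rw [hl']; ring
  rw [h3]
  nlinarith

/-! ### Rate of convergence -/

theorem one_div_sq_le_telescope {t : ℕ} (ht : 1 ≤ t) :
    1 / (t : ℝ) ^ 2 ≤ 2 * (1 / (t : ℝ) - 1 / ((t + 1 : ℕ) : ℝ)) := by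
  have h1 : (1 : ℝ) ≤ t := by exact_mod_cast ht
  have : 2 * (1 / (t : ℝ) - 1 / ((t + 1 : ℕ) : ℝ)) = 2 / (t * (t + 1)) := by
    push_cast; field_simp; ring
  rw [this, div_le_div_iff₀ (by positivity) (by positivity)]
  nlinarith

/-- Rate of a summable and almost nonincreasing sequence of gaps `a`, with squared distances `D`
decreasing up to summable errors. The averages of `a` are `O(1/T)`, and since the tail of the
errors is `O(1/T)` too, the last gap inherits the rate from the second half of the sequence. -/
theorem last_gap_le {σ : ℝ} (hβ : 0 < β) (hσ : 0 < σ) {a D e : ℕ → ℝ} {T : ℕ} (hT : 2 ≤ T)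
    (ha : ∀ t, 1 ≤ t → t ≤ T + 1 → 0 ≤ a t) (hD : ∀ t, 0 ≤ D t)
    (he : ∀ t, 1 ≤ t → t ≤ T → e t ≤ σ / (t : ℝ) ^ 2)
    (hstep : ∀ t, 1 ≤ t → t ≤ T → a (t + 1) ≤ a t + e t)
    (hdist : ∀ t, 1 ≤ t → t ≤ T → D (t + 1) + β * a (t + 1) ≤ D t + 2 * β * e t) :
    D T ≤ D 1 + 4 * β * σ ∧ a T ≤ (2 * ((D 1 + 4 * β * σ) / β) + 4 * σ) / T := by
  have he' : ∀ t, 1 ≤ t → t ≤ T → e t ≤ 2 * σ / t - 2 * σ / ((t + 1 : ℕ) : ℝ) := by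
    intro t h1 h2
    have := mul_le_mul_of_nonneg_left (one_div_sq_le_telescope h1) hσ.le
    calc e t ≤ σ / (t : ℝ) ^ 2 := he t h1 h2
      _ = σ * (1 / (t : ℝ) ^ 2) := by ring
      _ ≤ _ := this
      _ = _ := by ring
  have hTpos : (0 : ℝ) < T := by exact_mod_cast (by omega : 0 < T)
  have hsum : ∀ t, 1 ≤ t → t ≤ T →
      D t + β * ∑ s ∈ Finset.Ioc 1 t, a s ≤ D 1 + 4 * β * σ - 2 * β * (2 * σ / t) := by
    intro t ht
    induction t, ht using Nat.le_induction with
    | base => intro _; simp; linarith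
    | succ t ht ih =>
      intro htT
      have h1 := ih (by omega)
      have h2 := hdist t ht (by omega)
      have h3 := mul_le_mul_of_nonneg_left (he' t ht (by omega)) (by positivity : 0 ≤ 2 * β)
      rw [← Finset.insert_Ioc_right_eq_Ioc_add_one ht, Finset.sum_insert (by simp)]
      linarith
  have hS := hsum T (by omega) le_rfl
  have hS0 : 0 ≤ ∑ s ∈ Finset.Ioc 1 T, a s := Finset.sum_nonneg fun s hs => by
    rw [Finset.mem_Ioc] at hs; exact ha s (by omega) (by omega)
  have hσT : 0 ≤ 2 * β * (2 * σ / T) := by positivity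
  refine ⟨by nlinarith, ?_⟩
  have hanti : ∀ s, 1 ≤ s → ∀ t, s ≤ t → t ≤ T → a t + 2 * σ / t ≤ a s + 2 * σ / s := by
    intro s hs t hst
    induction t, hst using Nat.le_induction with
    | base => intro _; exact le_rfl
    | succ t ht ih =>
      intro htT
      have h1 := ih (by omega)
      have h2 := hstep t (by omega) (by omega)
      have h3 := he' t (by omega) (by omega)
      linarith
  have hhalf : ∀ s ∈ Finset.Ioc (T / 2) T, a T - 4 * σ / T ≤ a s := by
    intro s hs
    rw [Finset.mem_Ioc] at hs
    have h1 := hanti s (by omega) T hs.2 le_rfl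
    have h2 : (T : ℝ) ≤ 2 * s := by exact_mod_cast (by omega : T ≤ 2 * s)
    have h3 : 2 * σ / s ≤ 4 * σ / T := by
      rw [div_le_div_iff₀ (by linarith) hTpos]
      nlinarith
    have h4 : 0 ≤ 2 * σ / T := by positivity
    linarith
  have hcard := Finset.card_nsmul_le_sum _ _ _ hhalf
  rw [Nat.card_Ioc, nsmul_eq_mul] at hcard
  have hsub : ∑ s ∈ Finset.Ioc (T / 2) T, a s ≤ ∑ s ∈ Finset.Ioc 1 T, a s := by
    refine Finset.sum_le_sum_of_subset_of_nonneg
      (Finset.Ioc_subset_Ioc_left (by omega)) fun s hs _ => ?_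
    rw [Finset.mem_Ioc] at hs; exact ha s (by omega) (by omega)
  have hK : ∑ s ∈ Finset.Ioc 1 T, a s ≤ (D 1 + 4 * β * σ) / β := by
    rw [le_div_iff₀ hβ]
    nlinarith [hD T]
  have hT2 : (T : ℝ) / 2 ≤ ((T - T / 2 : ℕ) : ℝ) := by
    rw [div_le_iff₀ two_pos]
    exact_mod_cast (by omega : T ≤ (T - T / 2) * 2)
  rw [le_div_iff₀ hTpos]
  have hσ4 : 4 * σ / T * T = 4 * σ := div_mul_cancel₀ _ hTpos.ne'
  rcases le_total (a T - 4 * σ / T) 0 with hneg | hpos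
  · nlinarith
  · nlinarith [mul_le_mul_of_nonneg_right hT2 hpos]

/-- Last-iterate guarantee of the inexact augmented Lagrangian method on a compact convex set of
attainable pairs `(f, g)`, given an optimal pair `zs` and a Lagrange multiplier `ls`. -/
theorem exists_rate (hβ : 0 < β) {σ : ℝ} (hσ : 0 < σ) (hZ : IsCompact Z) (hconv : Convex ℝ Z)
    {zs : ℝ × (ι → ℝ)} (hzs : zs ∈ Z) (hzs0 : ∀ i, 0 ≤ zs.2 i)
    {ls : ι → ℝ} (hls0 : ∀ i, 0 ≤ ls i) (hls : ∀ z ∈ Z, z.1 + ∑ i, ls i * z.2 i ≤ zs.1) :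
    ∃ C : ℝ, 0 < C ∧ ∀ ε : ℝ, 0 < ε → ε < 1 → ∀ T : ℕ, C / ε ^ 2 ≤ (T : ℝ) →
      ∀ e : ℕ → ℝ, (∀ t : ℕ, 1 ≤ t → t ≤ T → 0 ≤ e t ∧ e t ≤ σ / (t : ℝ) ^ 2) →
      ∀ (z : ℕ → ℝ × (ι → ℝ)) (l : ℕ → ι → ℝ), l 1 = 0 →
        (∀ t, 1 ≤ t → t ≤ T → z (t + 1) ∈ Z ∧
          ∀ z' ∈ Z, lagr β z' (l t) - e t ≤ lagr β (z (t + 1)) (l t)) →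
        (∀ t, 1 ≤ t → t ≤ T → ∀ i,
          l (t + 1) i = l t i - β / 2 * grad β ((z (t + 1)).2 i) (l t i)) →
        zs.1 - ε ≤ (z (T + 1)).1 ∧ ∀ i, -ε ≤ (z (T + 1)).2 i := by
  set L : ℝ := ∑ i, ls i ^ 2 with hL
  have hL0 : 0 ≤ L := Finset.sum_nonneg fun i _ => sq_nonneg _
  -- `R / T` bounds the gap, `H / T` the squared gradient, and `N` the squared multiplier.
  set R : ℝ := 2 * ((L + 4 * β * σ) / β) + 4 * σ with hR
  set H : ℝ := 4 / β * (R + σ) with hH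
  set N : ℝ := 2 * (L + 4 * β * σ) + 2 * L with hN
  have hR0 : 0 < R := by positivity
  have hH0 : 0 < H := by positivity
  have hN0 : 0 < N := by positivity
  refine ⟨2 + 2 * σ + H + 4 * (N * H), by positivity, ?_⟩
  intro ε hε hε1 T hT e he z l hl1 hz hdual
  have hCT : 2 + 2 * σ + H + 4 * (N * H) ≤ T * ε ^ 2 := by
    rwa [div_le_iff₀ (by positivity)] at hT
  have hNH : 0 < N * H := by positivity
  have hεsq : ε ^ 2 < ε := by nlinarith
  have hT2r : (2 : ℝ) ≤ T := by nlinarith [(Nat.cast_nonneg T : (0 : ℝ) ≤ T)]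
  have hT2 : 2 ≤ T := by exact_mod_cast hT2r
  have hTpos : (0 : ℝ) < T := by linarith
  have hne : Z.Nonempty := ⟨zs, hzs⟩
  have hlow : ∀ t, zs.1 ≤ envelope β Z (l t) := fun t => by
    refine le_trans ?_ (lagr_le_envelope hZ hzs _)
    exact le_add_of_nonneg_right
      (Finset.sum_nonneg fun i _ => term_nonneg hβ (hzs0 i) _)
  have hup : envelope β Z ls ≤ zs.1 := envelope_le hne fun z hz => by
    refine le_trans ?_ (hls z hz)
    unfold lagr
    gcongr with i
    simpa using term_le hβ (z.2 i) (ls i) (hls0 i)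
  have horacle : ∀ t, 1 ≤ t → t ≤ T →
      envelope β Z (l t) - e t ≤ lagr β (z (t + 1)) (l t) := fun t h1 h2 => by
    rw [sub_le_iff_le_add]
    exact envelope_le hne fun z' hz' => sub_le_iff_le_add.1 ((hz t h1 h2).2 z' hz')
  have hstep := fun t h1 h2 =>
    envelope_step_le hβ hZ hconv (hz t h1 h2).1 (horacle t h1 h2) (hdual t h1 h2)
  have hgrad0 : ∀ t, 0 ≤ β / 4 * ∑ i, grad β ((z (t + 1)).2 i) (l t i) ^ 2 := fun t =>
    mul_nonneg (by positivity) (Finset.sum_nonneg fun i _ => sq_nonneg _)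
  obtain ⟨hdistT, hgapT⟩ := last_gap_le (a := fun t => envelope β Z (l t) - zs.1)
    (D := fun t => ∑ i, (l t i - ls i) ^ 2) (e := e) hβ hσ hT2
    (fun t _ _ => sub_nonneg.2 (hlow t))
    (fun t => Finset.sum_nonneg fun i _ => sq_nonneg _) (fun t h1 h2 => (he t h1 h2).2)
    (fun t h1 h2 => by have := hstep t h1 h2; have := hgrad0 t; linarith)
    (fun t h1 h2 => sum_sq_step_le hβ hZ hconv (hz t h1 h2).1 (horacle t h1 h2)
      (hdual t h1 h2) hup)
  have hD1 : ∑ i, (l 1 i - ls i) ^ 2 = L := by simp [hl1, hL]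
  simp only [hD1] at hdistT hgapT
  rw [← hR] at hgapT
  have heT : e T ≤ σ / T := by
    refine (he T (by omega) le_rfl).2.trans ?_
    gcongr
    nlinarith
  set G : ℝ := ∑ i, grad β ((z (T + 1)).2 i) (l T i) ^ 2 with hG
  have hG0 : 0 ≤ G := Finset.sum_nonneg fun i _ => sq_nonneg _
  have hGT : G * T ≤ H := by
    have h1 := hstep T (by omega) le_rfl
    have h2 := hlow (T + 1)
    have h3 : β / 4 * G ≤ R / T + σ / T := by linarith
    rw [← add_div, le_div_iff₀ hTpos] at h3
    have h4 := mul_le_mul_of_nonneg_left h3 (by positivity : 0 ≤ 4 / β)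
    calc G * T = 4 / β * (β / 4 * G * T) := by field_simp
      _ ≤ H := h4
  have hGε : G ≤ ε ^ 2 := by
    refine le_of_mul_le_mul_right ?_ hTpos
    linarith
  constructor
  · have hsq : ∑ i, l T i ^ 2 ≤ N := by
      have : ∑ i, l T i ^ 2 ≤ ∑ i, (2 * (l T i - ls i) ^ 2 + 2 * ls i ^ 2) :=
        Finset.sum_le_sum fun i _ => by nlinarith [sq_nonneg (l T i - 2 * ls i)]
      rw [Finset.sum_add_distrib, ← Finset.mul_sum, ← Finset.mul_sum] at this
      linarith
    have hcs := Finset.sum_mul_sq_le_sq_mul_sq Finset.univ (l T)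
      fun i => grad β ((z (T + 1)).2 i) (l T i)
    set P : ℝ := ∑ i, l T i * grad β ((z (T + 1)).2 i) (l T i) with hP
    have hPsq : P ^ 2 ≤ (ε / 2) ^ 2 := by
      have h1 : P ^ 2 ≤ N * G := hcs.trans (mul_le_mul_of_nonneg_right hsq hG0)
      refine h1.trans (le_of_mul_le_mul_right ?_ hTpos)
      have := mul_le_mul_of_nonneg_left hGT hN0.le
      nlinarith
    have hPε : P ≤ ε / 2 := (abs_le_of_sq_le_sq' hPsq (by positivity)).2
    have heε : e T ≤ ε / 2 := by
      refine heT.trans ?_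
      rw [div_le_iff₀ hTpos]
      nlinarith
    have h1 := horacle T (by omega) le_rfl
    have h2 := hlow T
    have h3 : lagr β (z (T + 1)) (l T) ≤ (z (T + 1)).1 + P := by
      unfold lagr
      rw [hP]
      gcongr with i
      exact term_le_mul_grad hβ _ _
    linarith
  · intro i
    have h1 : grad β ((z (T + 1)).2 i) (l T i) ^ 2 ≤ ε ^ 2 :=
      (Finset.single_le_sum (f := fun i => grad β ((z (T + 1)).2 i) (l T i) ^ 2)
        (fun i _ => sq_nonneg _) (Finset.mem_univ i)).trans hGε
    exact (abs_le_of_sq_le_sq' h1 hε.le).1.trans (min_le_left _ _)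

end AugLagrangian

/-! ### Occupancy measures -/

namespace CMDP

variable {S A : Type*} [Fintype S] [Fintype A] {m : ℕ} (M : CMDP S A m)

theorem stateActionProb_nonneg (π : Policy S A) (s₀ : S) (a₀ : A) (τ : ℕ) (s : S) (a : A) :
    0 ≤ M.stateActionProb π s₀ a₀ τ s a := by
  induction τ generalizing s a with
  | zero => simp only [stateActionProb]; split_ifs <;> norm_num
  | succ τ ih =>
    simp only [stateActionProb]
    exact mul_nonneg (Finset.sum_nonneg fun s _ => Finset.sum_nonneg fun a _ =>
      mul_nonneg (ih s a) (stdSimplex.zero_le (M.P s a) _)) (stdSimplex.zero_le (π s) a)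

theorem sum_flow_mul (d : S → A → ℝ) (w : S → ℝ) :
    ∑ s', (∑ s, ∑ a, d s a * (M.P s a : S → ℝ) s') * w s'
      = ∑ s, ∑ a, d s a * ∑ s', (M.P s a : S → ℝ) s' * w s' := by
  simp only [Finset.sum_mul, Finset.mul_sum]
  rw [Finset.sum_comm]
  refine Finset.sum_congr rfl fun s _ => ?_
  rw [Finset.sum_comm]
  exact Finset.sum_congr rfl fun a _ => Finset.sum_congr rfl fun s' _ => by ring

theorem sum_flow (d : S → A → ℝ) :
    ∑ s', ∑ s, ∑ a, d s a * (M.P s a : S → ℝ) s' = ∑ s, ∑ a, d s a := by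
  have := M.sum_flow_mul d 1
  simpa [stdSimplex.sum_eq_one] using this

theorem sum_stateActionProb (π : Policy S A) (s₀ : S) (a₀ : A) (τ : ℕ) :
    ∑ s, ∑ a, M.stateActionProb π s₀ a₀ τ s a = 1 := by
  classical
  induction τ with
  | zero =>
    simp only [stateActionProb, ite_and]
    simp
  | succ τ ih =>
    simp only [stateActionProb, ← Finset.mul_sum, stdSimplex.sum_eq_one, mul_one]
    rw [sum_flow, ih]

theorem stateActionProb_le_one (π : Policy S A) (s₀ : S) (a₀ : A) (τ : ℕ) (s : S) (a : A) :
    M.stateActionProb π s₀ a₀ τ s a ≤ 1 := by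
  rw [← M.sum_stateActionProb π s₀ a₀ τ]
  have h := M.stateActionProb_nonneg π s₀ a₀ τ
  exact (Finset.single_le_sum (fun a _ => h s a) (Finset.mem_univ a)).trans
    (Finset.single_le_sum (f := fun s => ∑ a, M.stateActionProb π s₀ a₀ τ s a)
      (fun s _ => Finset.sum_nonneg fun a _ => h s a) (Finset.mem_univ s))

theorem summable_stateActionProb (π : Policy S A) (s₀ : S) (a₀ : A) (s : S) (a : A) :
    Summable fun τ : ℕ => M.γ ^ τ * M.stateActionProb π s₀ a₀ τ s a := by
  refine Summable.of_nonneg_of_le (fun τ => mul_nonneg (pow_nonneg M.γ_mem.1 _)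
    (M.stateActionProb_nonneg π s₀ a₀ τ s a)) (fun τ => ?_)
    (summable_geometric_of_lt_one M.γ_mem.1 M.γ_mem.2)
  exact mul_le_of_le_one_right (pow_nonneg M.γ_mem.1 _)
    (M.stateActionProb_le_one π s₀ a₀ τ s a)

/-- The discounted occupancy measure of the chain started at `(s₀, a₀)`. -/
def occupancyFrom (π : Policy S A) (s₀ : S) (a₀ : A) (s : S) (a : A) : ℝ :=
  ∑' τ : ℕ, M.γ ^ τ * M.stateActionProb π s₀ a₀ τ s a

/-- The discounted occupancy measure of `π` from the initial distribution; it is not normalised,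
its total mass is `1 / (1 - γ)`. -/
def occupancy (π : Policy S A) (s : S) (a : A) : ℝ :=
  ∑ s₀, (M.ρ : S → ℝ) s₀ * ∑ a₀, (π s₀ : A → ℝ) a₀ * M.occupancyFrom π s₀ a₀ s a

/-- The linear functional `d ↦ ∑ d(s, a) f(s, a)`. -/
def pairing (f : S → A → ℝ) : (S → A → ℝ) →ₗ[ℝ] ℝ where
  toFun d := ∑ s, ∑ a, d s a * f s a
  map_add' d d' := by simp only [Pi.add_apply, add_mul, Finset.sum_add_distrib]
  map_smul' x d := by
    simp only [Pi.smul_apply, smul_eq_mul, mul_assoc, Finset.mul_sum, RingHom.id_apply]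

theorem pairing_apply (f d : S → A → ℝ) : pairing f d = ∑ s, ∑ a, d s a * f s a := rfl

theorem Q_eq_pairing (f : S → A → ℝ) (π : Policy S A) (s₀ : S) (a₀ : A) :
    M.Q f π s₀ a₀ = pairing f (M.occupancyFrom π s₀ a₀) := by
  have h : HasSum (fun τ : ℕ => ∑ s, ∑ a, M.γ ^ τ * M.stateActionProb π s₀ a₀ τ s a * f s a)
      (∑ s, ∑ a, M.occupancyFrom π s₀ a₀ s a * f s a) :=
    hasSum_sum fun s _ => hasSum_sum fun a _ =>
      (M.summable_stateActionProb π s₀ a₀ s a).hasSum.mul_right _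
  rw [pairing_apply, ← h.tsum_eq, Q]
  simp only [Finset.mul_sum, mul_assoc]

theorem occupancy_eq (π : Policy S A) :
    M.occupancy π = ∑ s₀, (M.ρ : S → ℝ) s₀ • ∑ a₀, (π s₀ : A → ℝ) a₀ •
      M.occupancyFrom π s₀ a₀ := by
  ext s a
  simp [occupancy, Finset.sum_apply]

theorem value_eq_pairing (f : S → A → ℝ) (π : Policy S A) :
    M.value f π = pairing f (M.occupancy π) := by
  simp only [occupancy_eq, map_sum, map_smul, smul_eq_mul, value, V, Q_eq_pairing]

theorem occupancyFrom_nonneg (π : Policy S A) (s₀ : S) (a₀ : A) (s : S) (a : A) :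
    0 ≤ M.occupancyFrom π s₀ a₀ s a :=
  tsum_nonneg fun τ => mul_nonneg (pow_nonneg M.γ_mem.1 _)
    (M.stateActionProb_nonneg π s₀ a₀ τ s a)

theorem occupancy_nonneg (π : Policy S A) (s : S) (a : A) : 0 ≤ M.occupancy π s a :=
  Finset.sum_nonneg fun s₀ _ => mul_nonneg (stdSimplex.zero_le M.ρ s₀) <| Finset.sum_nonneg fun a₀ _ =>
    mul_nonneg (stdSimplex.zero_le (π s₀) a₀) (M.occupancyFrom_nonneg π s₀ a₀ s a)

open Classical in
theorem occupancyFrom_eq (π : Policy S A) (s₀ : S) (a₀ : A) (s' : S) (a' : A) :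
    M.occupancyFrom π s₀ a₀ s' a' = (if s' = s₀ ∧ a' = a₀ then 1 else 0)
      + M.γ * pairing (fun s a => (M.P s a : S → ℝ) s') (M.occupancyFrom π s₀ a₀)
        * (π s' : A → ℝ) a' := by
  have h : HasSum (fun τ : ℕ => ∑ s, ∑ a, M.γ ^ τ * M.stateActionProb π s₀ a₀ τ s a *
      (M.P s a : S → ℝ) s')
      (pairing (fun s a => (M.P s a : S → ℝ) s') (M.occupancyFrom π s₀ a₀)) :=
    hasSum_sum fun s _ => hasSum_sum fun a _ =>
      (M.summable_stateActionProb π s₀ a₀ s a).hasSum.mul_right _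
  have h' := (h.mul_left M.γ).mul_right ((π s' : A → ℝ) a')
  rw [occupancyFrom, (M.summable_stateActionProb π s₀ a₀ s' a').tsum_eq_zero_add, ← h'.tsum_eq]
  simp only [pow_zero, one_mul, stateActionProb]
  congr 1
  refine tsum_congr fun τ => ?_
  simp only [pow_succ, Finset.mul_sum, Finset.sum_mul]
  exact Finset.sum_congr rfl fun s _ => Finset.sum_congr rfl fun a _ => by ring

/-- The balance equation of the occupancy measure. -/
theorem occupancy_balance (π : Policy S A) (s' : S) (a' : A) :
    M.occupancy π s' a' = ((M.ρ : S → ℝ) s'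
      + M.γ * pairing (fun s a => (M.P s a : S → ℝ) s') (M.occupancy π)) * (π s' : A → ℝ) a' := by
  classical
  conv_lhs => unfold occupancy
  simp only [occupancyFrom_eq, occupancy_eq, map_sum, map_smul, smul_eq_mul, mul_add,
    Finset.sum_add_distrib, add_mul]
  congr 1
  · rw [Finset.sum_eq_single s' (by intro s₀ _ h; simp [h.symm]) (by simp)]
    simp
  · simp only [Finset.mul_sum, Finset.sum_mul]
    exact Finset.sum_congr rfl fun s _ => Finset.sum_congr rfl fun a _ => by ring

/-- The polytope cut out by nonnegativity and the balance equations of a CMDP. -/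
def occupancySet : Set (S → A → ℝ) :=
  {d | (∀ s a, 0 ≤ d s a) ∧ ∀ s', ∑ a, d s' a = (M.ρ : S → ℝ) s'
    + M.γ * pairing (fun s a => (M.P s a : S → ℝ) s') d}

theorem occupancy_mem (π : Policy S A) : M.occupancy π ∈ M.occupancySet :=
  ⟨M.occupancy_nonneg π, fun s' => by
    rw [Finset.sum_congr rfl fun a _ => M.occupancy_balance π s' a, ← Finset.mul_sum, stdSimplex.sum_eq_one,
      mul_one]⟩

/-- Total mass of a solution of the balance equations with initial mass `τ`. -/
theorem one_sub_mul_mass {d : S → A → ℝ} {τ : ℝ}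
    (hd : ∀ s', ∑ a, d s' a = τ * (M.ρ : S → ℝ) s'
      + M.γ * pairing (fun s a => (M.P s a : S → ℝ) s') d) :
    (1 - M.γ) * ∑ s, ∑ a, d s a = τ := by
  have h := Finset.sum_congr rfl fun s' (_ : s' ∈ Finset.univ) => hd s'
  rw [Finset.sum_add_distrib, ← Finset.mul_sum, ← Finset.mul_sum, stdSimplex.sum_eq_one] at h
  simp only [pairing_apply] at h
  rw [sum_flow] at h
  linarith

/-- The balance equations of a fixed policy have at most one solution, because the discounted
transition operator contracts the `ℓ¹` norm. -/
theorem eq_zero_of_balance (π : Policy S A) {u : S → A → ℝ}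
    (hu : ∀ s' a', u s' a' =
      M.γ * pairing (fun s a => (M.P s a : S → ℝ) s') u * (π s' : A → ℝ) a') : u = 0 := by
  have h1 : ∑ s, ∑ a, |u s a| ≤ M.γ * ∑ s, ∑ a, |u s a| := by
    calc ∑ s', ∑ a', |u s' a'|
        ≤ ∑ s', ∑ a', M.γ * (∑ s, ∑ a, |u s a| * (M.P s a : S → ℝ) s') * (π s' : A → ℝ) a' := by
          refine Finset.sum_le_sum fun s' _ => Finset.sum_le_sum fun a' _ => ?_
          rw [hu, abs_mul, abs_mul, abs_of_nonneg M.γ_mem.1, abs_of_nonneg (stdSimplex.zero_le (π s') a')]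
          refine mul_le_mul_of_nonneg_right (mul_le_mul_of_nonneg_left ?_ M.γ_mem.1)
            (stdSimplex.zero_le (π s') a')
          rw [pairing_apply]
          refine (Finset.abs_sum_le_sum_abs _ _).trans (Finset.sum_le_sum fun s _ =>
            (Finset.abs_sum_le_sum_abs _ _).trans (Finset.sum_le_sum fun a _ => ?_))
          rw [abs_mul, abs_of_nonneg (stdSimplex.zero_le (M.P s a) s')]
      _ = M.γ * ∑ s, ∑ a, |u s a| := by
          simp only [← Finset.mul_sum, stdSimplex.sum_eq_one, mul_one]
          rw [sum_flow]
  have h0 : ∑ s, ∑ a, |u s a| = 0 := by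
    refine le_antisymm ?_ (Finset.sum_nonneg fun s _ => Finset.sum_nonneg fun a _ => abs_nonneg _)
    nlinarith [M.γ_mem.2]
  ext s a
  rw [Finset.sum_eq_zero_iff_of_nonneg
    fun s _ => Finset.sum_nonneg fun a _ => abs_nonneg _] at h0
  have := h0 s (Finset.mem_univ s)
  rw [Finset.sum_eq_zero_iff_of_nonneg fun a _ => abs_nonneg _] at this
  exact abs_eq_zero.1 (this a (Finset.mem_univ a))

/-- Every point of the polytope is the occupancy measure of a policy, namely of its conditional
distribution given the state; the policy `π₀` is used on states of mass zero. -/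
theorem exists_occupancy_eq (π₀ : Policy S A) {d : S → A → ℝ} (hd : d ∈ M.occupancySet) :
    ∃ π : Policy S A, M.occupancy π = d := by
  obtain ⟨hd0, hbal⟩ := hd
  have hmarg : ∀ s, 0 ≤ ∑ a, d s a := fun s => Finset.sum_nonneg fun a _ => hd0 s a
  have hex : ∀ s, ∃ p : stdSimplex ℝ A, ∀ a : A, d s a = (∑ a, d s a) * (p : A → ℝ) a := by
    intro s
    by_cases h : ∑ a, d s a = 0
    · refine ⟨π₀ s, fun a => ?_⟩
      rw [h, zero_mul]
      exact (Finset.sum_eq_zero_iff_of_nonneg fun a _ => hd0 s a).1 h a (Finset.mem_univ a)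
    · refine ⟨⟨fun a => d s a / ∑ a, d s a, fun a => div_nonneg (hd0 s a) (hmarg s), ?_⟩,
        fun a => ?_⟩
      · rw [← Finset.sum_div, div_self h]
      · exact (mul_div_cancel₀ _ h).symm
  choose π hπ using hex
  refine ⟨π, sub_eq_zero.1 (M.eq_zero_of_balance π fun s' a' => ?_)⟩
  rw [map_sub, Pi.sub_apply, Pi.sub_apply, occupancy_balance, hπ s' a', hbal s']
  ring

theorem convex_occupancySet : Convex ℝ M.occupancySet := by
  rintro d ⟨hd0, hd⟩ d' ⟨hd0', hd'⟩ x y hx hy hxy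
  refine ⟨fun s a => add_nonneg (mul_nonneg hx (hd0 s a)) (mul_nonneg hy (hd0' s a)),
    fun s' => ?_⟩
  simp only [Pi.add_apply, Pi.smul_apply, smul_eq_mul, map_add, map_smul, Finset.sum_add_distrib,
    ← Finset.mul_sum, hd, hd']
  linear_combination ((M.ρ : S → ℝ) s') * hxy

theorem continuous_pairing (f : S → A → ℝ) : Continuous (pairing f) := by
  change Continuous fun d : S → A → ℝ => ∑ s, ∑ a, d s a * f s a
  fun_prop

theorem isCompact_occupancySet : IsCompact M.occupancySet := by
  refine IsCompact.of_isClosed_subset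
    (isCompact_univ_pi fun _ : S => isCompact_univ_pi fun _ : A =>
      (isCompact_Icc : IsCompact (Set.Icc (0 : ℝ) (1 / (1 - M.γ))))) ?_ ?_
  · simp only [occupancySet, Set.ofPred_and, Set.ofPred_forall]
    refine IsClosed.inter (isClosed_iInter fun s => isClosed_iInter fun a =>
      isClosed_le continuous_const (by fun_prop)) (isClosed_iInter fun s' => isClosed_eq
        (by fun_prop) ?_)
    exact continuous_const.add (continuous_const.mul (continuous_pairing _))
  · rintro d ⟨hd0, hd⟩ s - a -
    refine ⟨hd0 s a, ?_⟩
    have h1 := M.one_sub_mul_mass (d := d) (τ := 1) (by simpa using hd)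
    rw [mul_comm, ← eq_div_iff (sub_pos.2 M.γ_mem.2).ne'] at h1
    rw [← h1]
    exact (Finset.single_le_sum (fun a _ => hd0 s a) (Finset.mem_univ a)).trans
      (Finset.single_le_sum (f := fun s => ∑ a, d s a)
        (fun s _ => Finset.sum_nonneg fun a _ => hd0 s a) (Finset.mem_univ s))

/-! ### Strong duality for a CMDP -/

/-- The objective and the constraint slacks `V_{c_i} - b_i` as functions of the occupancy
measure. -/
def outcome (d : S → A → ℝ) : ℝ × (Fin m → ℝ) :=
  (pairing M.r d, fun i => pairing (M.c i) d - M.b i)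

theorem outcome_occupancy (π : Policy S A) :
    M.outcome (M.occupancy π) = (M.value M.r π, fun i => M.value (M.c i) π - M.b i) := by
  simp only [outcome, value_eq_pairing]

theorem continuous_outcome : Continuous M.outcome :=
  (continuous_pairing _).prodMk (continuous_pi fun _ => (continuous_pairing _).sub
    continuous_const)

theorem convex_outcome_image : Convex ℝ (M.outcome '' M.occupancySet) := by
  rintro _ ⟨d, hd, rfl⟩ _ ⟨d', hd', rfl⟩ x y hx hy hxy
  refine ⟨_, M.convex_occupancySet hd hd' hx hy hxy, ?_⟩
  ext i
  · simp [outcome]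
  · simp only [outcome, map_add, map_smul, smul_eq_mul, Prod.snd_add, Prod.smul_snd, Pi.add_apply,
      Pi.smul_apply]
    linear_combination (M.b i) * hxy

/-- The homogenised balance equations: pairs `(d, τ)` such that `d` satisfies the balance
equations with initial distribution `τ • ρ`. -/
def balanceSpace : Submodule ℝ ((S → A → ℝ) × ℝ) where
  carrier := {w | ∀ s', ∑ a, w.1 s' a = w.2 * (M.ρ : S → ℝ) s'
    + M.γ * pairing (fun s a => (M.P s a : S → ℝ) s') w.1}
  zero_mem' s' := by simp
  add_mem' {w w'} hw hw' s' := by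
    simp only [Prod.fst_add, Prod.snd_add, Pi.add_apply, Finset.sum_add_distrib, map_add, hw s',
      hw' s']
    ring
  smul_mem' x w hw s' := by
    simp only [Prod.smul_fst, Prod.smul_snd, Pi.smul_apply, smul_eq_mul, ← Finset.mul_sum,
      map_smul, hw s']
    ring

/-- Existence of Lagrange multipliers. The problem is a linear program in the occupancy measure,
so feasibility suffices; Slater's condition is not needed. -/
theorem exists_multiplier {v : ℝ}
    (hv : ∀ d ∈ M.occupancySet, (∀ i, 0 ≤ (M.outcome d).2 i) → (M.outcome d).1 ≤ v) :
    ∃ l : Fin m → ℝ, (∀ i, 0 ≤ l i) ∧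
      ∀ d ∈ M.occupancySet, (M.outcome d).1 + ∑ i, l i * (M.outcome d).2 i ≤ v := by
  let p₁ : M.balanceSpace →ₗ[ℝ] S → A → ℝ := (LinearMap.fst ℝ _ _) ∘ₗ M.balanceSpace.subtype
  let p₂ : M.balanceSpace →ₗ[ℝ] ℝ := (LinearMap.snd ℝ _ _) ∘ₗ M.balanceSpace.subtype
  obtain ⟨l, hl, h⟩ := exists_multiplier_of_homogeneous
    (Sum.elim (fun k : S × A => LinearMap.proj k.2 ∘ₗ LinearMap.proj k.1 ∘ₗ p₁)
      (fun _ : Unit => p₂))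
    (fun i => pairing (M.c i) ∘ₗ p₁ - M.b i • p₂) (pairing M.r ∘ₗ p₁ - v • p₂) (by
      rintro ⟨⟨d, τ⟩, hbal⟩ hnn hg
      have hd : ∀ s a, 0 ≤ d s a := fun s a => hnn (Sum.inl (s, a))
      have hτ : 0 ≤ τ := hnn (Sum.inr ())
      have hc : ∀ i, 0 ≤ pairing (M.c i) d - M.b i * τ := hg
      change pairing M.r d - v * τ ≤ 0
      have hbal' : ∀ s', ∑ a, d s' a = τ * (M.ρ : S → ℝ) s'
        + M.γ * pairing (fun s a => (M.P s a : S → ℝ) s') d := hbal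
      rcases hτ.eq_or_lt with rfl | hτ
      · -- A direction of recession of the polytope vanishes, since its total mass does.
        have h0 := M.one_sub_mul_mass hbal'
        have h1 := (mul_eq_zero.1 h0).resolve_left (sub_pos.2 M.γ_mem.2).ne'
        rw [Finset.sum_eq_zero_iff_of_nonneg
          fun s _ => Finset.sum_nonneg fun a _ => hd s a] at h1
        have hd0 : d = 0 := by
          ext s a
          exact (Finset.sum_eq_zero_iff_of_nonneg fun a _ => hd s a).1
            (h1 s (Finset.mem_univ s)) a (Finset.mem_univ a)
        simp [hd0]
      · have hmem : τ⁻¹ • d ∈ M.occupancySet := by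
          refine ⟨fun s a => mul_nonneg (inv_nonneg.2 hτ.le) (hd s a), fun s' => ?_⟩
          simp only [Pi.smul_apply, smul_eq_mul, ← Finset.mul_sum, map_smul, hbal' s']
          field_simp
        have h1 := hv _ hmem fun i => by
          have h2 := mul_nonneg (inv_nonneg.2 hτ.le) (hc i)
          have h3 : τ⁻¹ * (pairing (M.c i) d - M.b i * τ) = τ⁻¹ * pairing (M.c i) d - M.b i := by
            field_simp
          rw [h3] at h2
          simpa [outcome] using h2
        simp only [outcome, map_smul, smul_eq_mul] at h1
        rw [inv_mul_le_iff₀ hτ] at h1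
        linarith)
  refine ⟨l, hl, fun d hd => ?_⟩
  have h1 := h ⟨(d, 1), fun s' => by simpa using hd.2 s'⟩ (by
    rintro (k | k)
    · exact hd.1 k.1 k.2
    · exact zero_le_one)
  change pairing M.r d - v * 1 + ∑ i, l i * (pairing (M.c i) d - M.b i * 1) ≤ 0 at h1
  simp only [mul_one] at h1
  simp only [outcome]
  linarith

theorem augLagrangian_eq_lagr {β : ℝ} (hβ : 0 < β) (π : Policy S A) (l : Fin m → ℝ) :
    M.augLagrangian β π l = AugLagrangian.lagr β (M.outcome (M.occupancy π)) l := by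
  rw [outcome_occupancy, augLagrangian, AugLagrangian.lagr, Finset.mul_sum]
  congr 1
  refine Finset.sum_congr rfl fun i _ => ?_
  set g := M.value (M.c i) π - M.b i
  have h : min (g - l i / β) 0 = -(max (l i - β * g) 0 / β) := by
    have h1 : max (l i - β * g) 0 / β = max ((l i - β * g) / β) (0 / β) :=
      (max_div_div_right hβ.le _ _).symm
    rw [h1, zero_div, ← min_neg_neg, neg_zero]
    congr 1
    field_simp
    ring
  rw [h, AugLagrangian.term]
  field_simp
  ring

theorem dual_step_eq {β : ℝ} (π : Policy S A) (l : Fin m → ℝ) (i : Fin m) :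
    l i - β / 2 * (M.value (M.c i) π - (M.b i + M.slack β l π i))
      = l i - β / 2 * AugLagrangian.grad β ((M.outcome (M.occupancy π)).2 i) (l i) := by
  rw [outcome_occupancy, slack, AugLagrangian.grad]
  simp only
  rcases le_total (M.value (M.c i) π - M.b i) (l i / β) with h | h
  · rw [min_eq_left h, max_eq_right (by linarith)]; ring
  · rw [min_eq_right h, max_eq_left (by linarith)]; ring

end CMDP

end

theorem theorem1 {S A : Type*} [Fintype S] [Fintype A] {m : ℕ} (M : CMDP S A m)
    (hfeas : ∃ π : Policy S A, M.Feasible π)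
    (β : ℝ) (hβ : 0 < β) (σ : ℝ) (hσ : 0 < σ) :
    ∃ C : ℝ, 0 < C ∧
      ∀ ε : ℝ, 0 < ε → ε < 1 →
      ∀ T : ℕ, C / ε ^ 2 ≤ (T : ℝ) →
      ∀ e : ℕ → ℝ, (∀ t : ℕ, 1 ≤ t → t ≤ T → 0 ≤ e t ∧ e t ≤ σ / (t : ℝ) ^ 2) →
      ∀ (π : ℕ → Policy S A) (lam : ℕ → Fin m → ℝ), M.IsALRun β e T π lam →
        M.IsApproxSolution ε (π (T + 1)) := by
  obtain ⟨π₀, hπ₀⟩ := hfeas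
  have hfeas_mem : ∀ π, M.Feasible π → ∀ i, 0 ≤ (M.outcome (M.occupancy π)).2 i :=
    fun π hπ i => by
      rw [M.outcome_occupancy]
      exact sub_nonneg.2 (hπ i)
  have hF : IsCompact (M.occupancySet ∩ {d | ∀ i, 0 ≤ (M.outcome d).2 i}) := by
    refine M.isCompact_occupancySet.inter_right ?_
    rw [Set.ofPred_forall]
    exact isClosed_iInter fun i => isClosed_le continuous_const
      ((continuous_apply i).comp (continuous_snd.comp M.continuous_outcome))
  obtain ⟨ds, ⟨hds, hds0⟩, hopt⟩ := hF.exists_isMaxOn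
    ⟨M.occupancy π₀, M.occupancy_mem π₀, hfeas_mem π₀ hπ₀⟩
    (continuous_fst.comp M.continuous_outcome).continuousOn
  obtain ⟨ls, hls0, hls⟩ := M.exists_multiplier fun d hd hd0 => hopt ⟨hd, hd0⟩
  obtain ⟨C, hC, hrate⟩ := AugLagrangian.exists_rate hβ hσ
    (M.isCompact_occupancySet.image M.continuous_outcome) M.convex_outcome_image
    (Set.mem_image_of_mem _ hds) hds0 hls0 (by rintro _ ⟨d, hd, rfl⟩; exact hls d hd)
  refine ⟨C, hC, fun ε hε hε1 T hT e he π lam hrun => ?_⟩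
  obtain ⟨hobj, hcon⟩ := hrate ε hε hε1 T hT e he (fun t => M.outcome (M.occupancy (π t))) lam
    hrun.init (fun t h1 h2 => ⟨Set.mem_image_of_mem _ (M.occupancy_mem _), by
      rintro _ ⟨d, hd, rfl⟩
      obtain ⟨π', rfl⟩ := M.exists_occupancy_eq π₀ hd
      have := hrun.primal t h1 h2 π'
      rwa [M.augLagrangian_eq_lagr hβ, M.augLagrangian_eq_lagr hβ] at this⟩)
    (fun t h1 h2 i => by rw [hrun.dual t h1 h2 i, M.dual_step_eq])
  refine ⟨fun π' hπ' => ?_, fun i => ?_⟩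
  · have h1 : (M.outcome (M.occupancy π')).1 ≤ (M.outcome ds).1 :=
      hopt ⟨M.occupancy_mem π', hfeas_mem π' hπ'⟩
    simp only [M.outcome_occupancy] at h1 hobj
    linarith
  · have h1 := hcon i
    simp only [M.outcome_occupancy] at h1
    linarith
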